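/- Let $\mathbb F=\mathbb R$ or $\mathbb C$, and let $\mathrm{Sym}_n=\mathrm{Sym}_n(\mathbb F)$ be the real vector space of self-adjoint $n\times n$ matrices over $\mathbb F$ (real symmetric, respectively complex Hermitian). Let $M$ be a $C^\infty$ manifold of dimension $d$ (without boundary, not necessarily compact), let $\mathcal F\colon M\to \mathrm{Sym}_n$ be a $C^\infty$ map, let $1\le k\le n$, and let $\lambda_k(y)$ be the $k$-th eigenvalue of $\mathcal F(y)$, where eigenvalues are repeated according to multiplicity and numbered in increasing order. Fix $x\in M$, let $\mathbf E_k\subset\mathbb F^n$ be the eigenspace of $\mathcal F(x)$ for the eigenvalue $\lambda_k(x)$, let $\nu=\dim_{\mathbb F}\mathbf E_k\ge 1$ be its multiplicity, and let $\mathcal U\colon \mathbb F^\nu\to\mathbb F^n$ be any linear isometry with range $\mathbf E_k$. Define the linear operator $$\mathcal H_x\colon T_xM\to \mathrm{Sym}_\nu,\qquad \mathcal H_x v=\mathcal U^*\big(d\mathcal F(x)v\big)\,\mathcal U .$$ Let $\mathrm{Sym}_\nu^{+}\subset\mathrm{Sym}_\nu$ be the set of positive semidefinite matrices, and let $S^\perp$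 denote the orthogonal complement of a subspace $S$ in $\mathrm{Sym}_\nu$ with respect to the Frobenius inner product $\langle X,Y\rangle=\operatorname{Tr}(XY)$. For a function $\phi\colon M\to\mathbb R$, a neighborhood $U$ of $x$ and $\epsilon>0$ put $U_x^{\pm\epsilon}(\phi)=\{y\in U:\phi(y)\le\phi(x)\pm\epsilon\}$. The point $x$ is called topologically regular for $\phi$ if there are arbitrarily small open neighborhoods $U$ of $x$, homeomorphic to a $d$-dimensional open ball, such that for all sufficiently small $\epsilon>0$ (depending on $U$) the set $U_x^{-\epsilon}(\phi)$ is a strong deformation retract of $U_x^{+\epsilon}(\phi)$. Then: 1. $\operatorname{Ran}\mathcal H_x$ contains a positive definite matrix if and only if $(\operatorname{Ran}\mathcal H_x)^\perp\cap \mathrm{Sym}_\nu^+=\{0\}$. 2. If these equivalent conditions hold, then $x$ is topologically regular for $\lambda_k$. -/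

import Mathlib

open scoped Manifold ContDiff Topology Matrix ComplexOrder

noncomputable section

/-- The real vector space `Sym_n(𝕜)` of self-adjoint `n × n` matrices (real symmetric for `𝕜 = ℝ`,
complex Hermitian for `𝕜 = ℂ`). -/
def SymMat (𝕜 : Type*) [RCLike 𝕜] (n : ℕ) : Type _ :=
  selfAdjoint.submodule ℝ (Matrix (Fin n) (Fin n) 𝕜)

section Norm

open scoped Matrix.Norms.Frobenius

/-- `Sym_n` is normed by the Frobenius norm. -/
instance (𝕜 : Type*) [RCLike 𝕜] (n : ℕ) : NormedAddCommGroup (SymMat 𝕜 n) :=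
  inferInstanceAs (NormedAddCommGroup (selfAdjoint.submodule ℝ (Matrix (Fin n) (Fin n) 𝕜)))

instance (𝕜 : Type*) [RCLike 𝕜] (n : ℕ) : NormedSpace ℝ (SymMat 𝕜 n) :=
  inferInstanceAs (NormedSpace ℝ (selfAdjoint.submodule ℝ (Matrix (Fin n) (Fin n) 𝕜)))

end Norm

namespace SymMat

variable {𝕜 : Type*} [RCLike 𝕜] {n ν : ℕ}

/-- The inclusion of `Sym_n` into the space of all `n × n` matrices. -/
def toMat : SymMat 𝕜 n →ₗ[ℝ] Matrix (Fin n) (Fin n) 𝕜 :=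
  (selfAdjoint.submodule ℝ (Matrix (Fin n) (Fin n) 𝕜)).subtype

theorem isHermitian (A : SymMat 𝕜 n) : (toMat A).IsHermitian :=
  A.2

theorem toMat_injective : Function.Injective (toMat : SymMat 𝕜 n → Matrix (Fin n) (Fin n) 𝕜) :=
  Subtype.val_injective

/-- The eigenvalues of `A`, repeated according to multiplicity and numbered in increasing order.
(Mathlib's `eigenvalues₀` is in decreasing order, hence `Fin.rev`.) -/
def eigval (A : SymMat 𝕜 n) (k : Fin n) : ℝ :=
  A.isHermitian.eigenvalues₀ (Fin.cast (Fintype.card_fin n).symm k.rev)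

/-- The eigenspace of `A` for its `k`-th eigenvalue. -/
def eigspace (A : SymMat 𝕜 n) (k : Fin n) : Submodule 𝕜 (EuclideanSpace 𝕜 (Fin n)) :=
  Module.End.eigenspace (Matrix.toEuclideanLin (toMat A))
    (A.eigval k : 𝕜)

/-- The compression `X ↦ U* X U`, as a real-linear map `Sym_n → Sym_ν`. -/
def compression (U : Matrix (Fin n) (Fin ν) 𝕜) : SymMat 𝕜 n →ₗ[ℝ] SymMat 𝕜 ν where
  toFun X := ⟨Uᴴ * (toMat X) * U,
    Matrix.isHermitian_conjTranspose_mul_mul U X.isHermitian⟩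
  map_add' X Y := by
    apply toMat_injective
    change Uᴴ * toMat (X + Y) * U = Uᴴ * toMat X * U + Uᴴ * toMat Y * U
    rw [map_add, Matrix.mul_add, Matrix.add_mul]
  map_smul' c X := by
    apply toMat_injective
    change Uᴴ * toMat (c • X) * U = c • (Uᴴ * toMat X * U)
    rw [map_smul, Matrix.mul_smul, Matrix.smul_mul]

/-- The Frobenius inner product `⟨X, Y⟩ = Tr (X Y)` on `Sym_ν` (the trace is a real number). -/
def frobInner (X Y : SymMat 𝕜 ν) : ℝ :=
  RCLike.re (Matrix.trace ((toMat X) * (toMat Y)))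

/-- The orthogonal complement in `Sym_ν` with respect to the Frobenius inner product. -/
def perp (S : Submodule ℝ (SymMat 𝕜 ν)) : Set (SymMat 𝕜 ν) :=
  {Y | ∀ X ∈ S, frobInner X Y = 0}

variable (𝕜 ν) in
/-- The cone of positive semidefinite matrices. -/
def psdCone : Set (SymMat 𝕜 ν) :=
  {Y | (toMat Y).PosSemidef}

end SymMat

/-- `U` is (the matrix of) a linear isometry `𝕜^ν → 𝕜^n` with range the subspace `E`, i.e. its
columns form an orthonormal basis of `E`. -/
def IsIsometryOnto {𝕜 : Type*} [RCLike 𝕜] {n ν : ℕ} (U : Matrix (Fin n) (Fin ν) 𝕜)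
    (E : Submodule 𝕜 (EuclideanSpace 𝕜 (Fin n))) : Prop :=
  Uᴴ * U = 1 ∧ LinearMap.range (Matrix.toEuclideanLin U) = E

/-- The operator `v ↦ U* (dF(x) v) U` from `T_x M` to `Sym_ν`. -/
def compressedDeriv {𝕜 : Type*} [RCLike 𝕜] {n ν : ℕ} (d : ℕ) {M : Type*} [TopologicalSpace M]
    [ChartedSpace (EuclideanSpace ℝ (Fin d)) M] (F : M → SymMat 𝕜 n) (x : M)
    (U : Matrix (Fin n) (Fin ν) 𝕜) : TangentSpace (𝓡 d) x →ₗ[ℝ] SymMat 𝕜 ν :=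
  SymMat.compression U ∘ₗ (mvfderiv (𝓡 d) F x).toLinearMap

/-- `A` is a strong deformation retract of `B`, for subsets `A`, `B` of a topological space: the
identity of `B` is homotopic in `B`, relative to `A`, to a map with values in `A`. -/
def IsStrongDeformationRetract {X : Type*} [TopologicalSpace X] (A B : Set X) : Prop :=
  A ⊆ B ∧ ∃ r : C(B, B), (∀ y, (r y : X) ∈ A) ∧
    Nonempty (ContinuousMap.HomotopyRel (ContinuousMap.id B) r {y : B | (y : X) ∈ A})

/-- The local sublevel set `{y ∈ U | φ y ≤ φ x + s}`; it is used with `s = ε` and `s = -ε`. -/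
def localSublevel {X : Type*} (φ : X → ℝ) (x : X) (U : Set X) (s : ℝ) : Set X :=
  {y | y ∈ U ∧ φ y ≤ φ x + s}

/-- `x` is a topologically regular point of `φ`, on a `d`-dimensional manifold: there are
arbitrarily small neighbourhoods `U` of `x`, homeomorphic to a ball, such that for all sufficiently
small `ε > 0` the sublevel set of `φ|U` at `φ x - ε` is a strong deformation retract of the one at
`φ x + ε`. -/
def IsTopologicallyRegular (d : ℕ) {M : Type*} [TopologicalSpace M] (φ : M → ℝ) (x : M) : Prop :=
  ∀ W ∈ 𝓝 x, ∃ U ⊆ W, IsOpen U ∧ x ∈ U ∧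
    Nonempty (U ≃ₜ Metric.ball (0 : EuclideanSpace ℝ (Fin d)) 1) ∧
    ∃ ε₀ : ℝ, 0 < ε₀ ∧ ∀ ε : ℝ, 0 < ε → ε ≤ ε₀ →
      IsStrongDeformationRetract (localSublevel φ x U (-ε)) (localSublevel φ x U ε)

end

/-! Part 1 is convex duality. The trace pairing of a positive definite matrix with a nonzero
positive semidefinite one is positive. Conversely, a subspace missing the open convex cone of
positive definite matrices is separated from it by a functional; the Frobenius matrix of its
negative is a nonzero positive semidefinite element of the orthogonal complement
(`SymMat.exists_posDef_iff`).

For Part 2, choose `w` with `U* (dF(x) w) U` positive definite. Although `λ_k` need not be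
differentiable, it grows at a definite rate along `w`. A min-max argument shows that `A + tB` has
`k`-th eigenvalue at least `λ_k(A) + ct` as soon as the form of `B` plus `K ‖(A - λ_k) u‖²` is at
least `c` on unit vectors and `t` is small. The penalty vanishes only on the eigenspace, so
positivity of `B` there suffices, and compactness makes `c`, `K` uniform near the given pair
(`SymMat.eventually_eigval_add_smul_ge`). Strict differentiability then allows difference quotients
of `F` to serve as `B` (`exists_eigval_increasing`).

Finally, a function growing at a definite rate along `w` has its level sets in a thin tube around
`w` as graphs over the transverse directions. Pushing points down along `w` to such a graph gives
the retraction (`isTopologicallyRegular_of_increasing`). -/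

/-- If `f > 0` on the zeros of `g ≥ 0` in a compact set, then `f + K g` is positive on the whole
compact set for large `K`, also after a small change of the parameter. -/
theorem IsCompact.exists_nat_forall_lt {P X : Type*} [TopologicalSpace P] [TopologicalSpace X]
    {S : Set X} (hS : IsCompact S) {f g : P × X → ℝ} (hf : Continuous f) (hg : Continuous g) (p₀ : P)
    (hg0 : ∀ u ∈ S, 0 ≤ g (p₀, u)) (hfg : ∀ u ∈ S, g (p₀, u) = 0 → 0 < f (p₀, u)) :
    ∃ K : ℕ, ∃ c > 0, ∀ᶠ p in 𝓝 p₀, ∀ u ∈ S, c < f (p, u) + K * g (p, u) := by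
  have hK : ∀ u ∈ S, ∃ K : ℕ, 0 < f (p₀, u) + K * g (p₀, u) := fun u hu => by
    rcases (hg0 u hu).eq_or_lt with h | h
    · exact ⟨0, by simpa using hfg u hu h.symm⟩
    · obtain ⟨K, hK⟩ := exists_lt_nsmul h (-f (p₀, u))
      rw [nsmul_eq_mul] at hK
      exact ⟨K, by linarith⟩
  have hcont (K : ℕ) : Continuous fun q => f q + K * g q := hf.add (continuous_const.mul hg)
  have hcont₀ (K : ℕ) : Continuous fun u => f (p₀, u) + K * g (p₀, u) :=
    (hcont K).comp (Continuous.prodMk_right p₀)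
  have hmono : ∀ u ∈ S, ∀ i j : ℕ, i ≤ j → f (p₀, u) + i * g (p₀, u) ≤ f (p₀, u) + j * g (p₀, u) :=
    fun u hu i j hij => by
      have : (i : ℝ) ≤ j := by exact_mod_cast hij
      have := mul_le_mul_of_nonneg_right this (hg0 u hu)
      linarith
  -- The open sets increase with `K` because `g ≥ 0`, so the largest index of a finite subcover
  -- works everywhere.
  obtain ⟨T, hT⟩ := hS.elim_finite_subcover (fun K : ℕ => {u | 0 < f (p₀, u) + K * g (p₀, u)})
    (fun K => isOpen_lt continuous_const (hcont₀ K)) fun u hu => Set.mem_iUnion.2 (hK u hu)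
  have hpos : ∀ u ∈ S, 0 < f (p₀, u) + (T.sup id : ℕ) * g (p₀, u) := fun u hu => by
    obtain ⟨i, hi, hiu⟩ := Set.mem_iUnion₂.1 (hT hu)
    exact lt_of_lt_of_le hiu (hmono u hu _ _ (Finset.le_sup (f := id) hi))
  obtain ⟨c, hc, hcu⟩ := hS.exists_forall_le' (hcont₀ (T.sup id)).continuousOn hpos
  refine ⟨T.sup id, c / 2, half_pos hc, hS.eventually_forall_of_forall_eventually fun u hu => ?_⟩
  exact (hcont _).continuousAt.eventually (lt_mem_nhds ((half_lt_self hc).trans_le (hcu u hu)))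

/-! ### Min-max estimates for the `k`-th eigenvalue -/

noncomputable section

namespace SymMat

variable {𝕜 : Type*} [RCLike 𝕜] {n : ℕ}

instance : FiniteDimensional ℝ (SymMat 𝕜 n) :=
  inferInstanceAs (FiniteDimensional ℝ (selfAdjoint.submodule ℝ (Matrix (Fin n) (Fin n) 𝕜)))

/-- The operator on Euclidean space defined by a self-adjoint matrix. -/
def toCLM : SymMat 𝕜 n →ₗ[ℝ] (EuclideanSpace 𝕜 (Fin n) →L[𝕜] EuclideanSpace 𝕜 (Fin n)) where
  toFun A := LinearMap.toContinuousLinearMap (Matrix.toEuclideanLin (toMat A))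
  map_add' A B := by simp
  map_smul' c A := by
    ext u i
    simp [Matrix.smul_mulVec]

theorem toCLM_apply (A : SymMat 𝕜 n) (u : EuclideanSpace 𝕜 (Fin n)) :
    toCLM A u = Matrix.toEuclideanLin (toMat A) u := rfl

theorem continuous_toCLM : Continuous (toCLM : SymMat 𝕜 n → _) :=
  LinearMap.continuous_of_finiteDimensional (𝕜 := ℝ) (toCLM (𝕜 := 𝕜) (n := n))

theorem mem_eigspace {A : SymMat 𝕜 n} {k : Fin n} {u : EuclideanSpace 𝕜 (Fin n)} :
    u ∈ A.eigspace k ↔ toCLM A u = (A.eigval k : 𝕜) • u :=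
  Module.End.mem_eigenspace_iff

theorem eigval_mono (A : SymMat 𝕜 n) : Monotone A.eigval := fun i j hij => by
  refine A.isHermitian.eigenvalues₀_antitone ?_
  rw [Fin.le_def, Fin.val_cast, Fin.val_cast]
  exact Fin.rev_le_rev.2 hij

/-- An orthonormal basis of eigenvectors, numbered like the eigenvalues `eigval`. -/
theorem exists_eigenbasis (A : SymMat 𝕜 n) :
    ∃ e : OrthonormalBasis (Fin n) 𝕜 (EuclideanSpace 𝕜 (Fin n)),
      ∀ i, toCLM A (e i) = (A.eigval i : 𝕜) • e i := by
  have hs := Matrix.isSymmetric_toEuclideanLin_iff.mpr A.isHermitian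
  refine ⟨(hs.eigenvectorBasis finrank_euclideanSpace).reindex
    ((finCongr (Fintype.card_fin n)).trans Fin.revPerm), fun i => ?_⟩
  rw [OrthonormalBasis.reindex_apply]
  exact hs.apply_eigenvectorBasis finrank_euclideanSpace _

theorem inner_toCLM_eq {A : SymMat 𝕜 n}
    {e : OrthonormalBasis (Fin n) 𝕜 (EuclideanSpace 𝕜 (Fin n))}
    (he : ∀ i, toCLM A (e i) = (A.eigval i : 𝕜) • e i) (u : EuclideanSpace 𝕜 (Fin n)) (i : Fin n) :
    inner 𝕜 (e i) (toCLM A u) = A.eigval i * inner 𝕜 (e i) u := by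
  have hs := Matrix.isSymmetric_toEuclideanLin_iff.mpr A.isHermitian
  have := hs (e i) u
  rw [← toCLM_apply, ← toCLM_apply, he, inner_smul_left] at this
  simpa using this.symm

theorem re_inner_toCLM_sub {A : SymMat 𝕜 n}
    {e : OrthonormalBasis (Fin n) 𝕜 (EuclideanSpace 𝕜 (Fin n))}
    (he : ∀ i, toCLM A (e i) = (A.eigval i : 𝕜) • e i) (c : ℝ) (u : EuclideanSpace 𝕜 (Fin n)) :
    RCLike.re (inner 𝕜 u (toCLM A u)) - c * ‖u‖ ^ 2 =
      ∑ i, (A.eigval i - c) * ‖inner 𝕜 (e i) u‖ ^ 2 := by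
  rw [← e.sum_inner_mul_inner u (toCLM A u), ← e.sum_sq_norm_inner_right u, map_sum, Finset.mul_sum,
    ← Finset.sum_sub_distrib]
  refine Finset.sum_congr rfl fun i _ => ?_
  rw [inner_toCLM_eq he, mul_left_comm, ← inner_conj_symm u (e i), RCLike.conj_mul,
    RCLike.re_ofReal_mul, ← RCLike.ofReal_pow, RCLike.ofReal_re, sub_mul]

theorem norm_toCLM_sub_sq {A : SymMat 𝕜 n}
    {e : OrthonormalBasis (Fin n) 𝕜 (EuclideanSpace 𝕜 (Fin n))}
    (he : ∀ i, toCLM A (e i) = (A.eigval i : 𝕜) • e i) (c : ℝ) (u : EuclideanSpace 𝕜 (Fin n)) :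
    ‖toCLM A u - (c : 𝕜) • u‖ ^ 2 = ∑ i, (A.eigval i - c) ^ 2 * ‖inner 𝕜 (e i) u‖ ^ 2 := by
  rw [← e.sum_sq_norm_inner_right]
  refine Finset.sum_congr rfl fun i _ => ?_
  rw [inner_sub_right, inner_toCLM_eq he, inner_smul_right, ← sub_mul, norm_mul, mul_pow,
    ← RCLike.ofReal_sub, RCLike.norm_ofReal, sq_abs]

/-- Two orthonormal bases share a unit vector in the span of the upper part of the first one and the
lower part of the second one. -/
theorem exists_norm_eq_one_of_bases (e e' : OrthonormalBasis (Fin n) 𝕜 (EuclideanSpace 𝕜 (Fin n)))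
    (k : Fin n) : ∃ u : EuclideanSpace 𝕜 (Fin n), ‖u‖ = 1 ∧
      (∀ i < k, inner 𝕜 (e i) u = 0) ∧ ∀ i, k < i → inner 𝕜 (e' i) u = 0 := by
  -- One linear condition for each `i ≠ k`: `n - 1` conditions in dimension `n` leave a nonzero
  -- solution.
  let f : EuclideanSpace 𝕜 (Fin n) →ₗ[𝕜] ({i // i ≠ k} → 𝕜) :=
    LinearMap.pi fun i => if i.1 < k then innerₛₗ 𝕜 (e i.1) else innerₛₗ 𝕜 (e' i.1)
  have hf : LinearMap.ker f ≠ ⊥ := by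
    apply LinearMap.ker_ne_bot_of_finrank_lt
    rw [Module.finrank_fintype_fun_eq_card, finrank_euclideanSpace, Fintype.card_subtype_compl]
    have := k.pos
    simp
    omega
  obtain ⟨u, hu, hu0⟩ := (Submodule.ne_bot_iff _).1 hf
  have hi : ∀ i (h : i ≠ k), (if i < k then innerₛₗ 𝕜 (e i) else innerₛₗ 𝕜 (e' i)) u = 0 :=
    fun i h => congrFun (LinearMap.mem_ker.1 hu) ⟨i, h⟩
  refine ⟨(‖u‖⁻¹ : 𝕜) • u, norm_smul_inv_norm hu0, fun i h => ?_, fun i h => ?_⟩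
  · rw [inner_smul_right, show inner 𝕜 (e i) u = 0 by simpa [h] using hi i h.ne, mul_zero]
  · rw [inner_smul_right, show inner 𝕜 (e' i) u = 0 by simpa [h.not_gt] using hi i h.ne', mul_zero]

/-- Weyl's inequality: on the shared unit vector the form of `A` is at least its `k`-th eigenvalue
and that of `B` at most its own. Continuity of eigenvalues follows. -/
theorem eigval_le_eigval_add_norm (A B : SymMat 𝕜 n) (k : Fin n) :
    A.eigval k ≤ B.eigval k + ‖toCLM A - toCLM B‖ := by
  obtain ⟨e, he⟩ := A.exists_eigenbasis
  obtain ⟨e', he'⟩ := B.exists_eigenbasis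
  obtain ⟨u, hu, h1, h2⟩ := exists_norm_eq_one_of_bases e e' k
  have hA : 0 ≤ RCLike.re (inner 𝕜 u (toCLM A u)) - A.eigval k * ‖u‖ ^ 2 := by
    rw [re_inner_toCLM_sub he]
    refine Finset.sum_nonneg fun i _ => ?_
    rcases lt_or_ge i k with h | h
    · simp [h1 i h]
    · exact mul_nonneg (sub_nonneg.2 (A.eigval_mono h)) (sq_nonneg _)
  have hB : RCLike.re (inner 𝕜 u (toCLM B u)) - B.eigval k * ‖u‖ ^ 2 ≤ 0 := by
    rw [re_inner_toCLM_sub he']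
    refine Finset.sum_nonpos fun i _ => ?_
    rcases lt_or_ge k i with h | h
    · simp [h2 i h]
    · exact mul_nonpos_of_nonpos_of_nonneg (sub_nonpos.2 (B.eigval_mono h)) (sq_nonneg _)
  have hAB : RCLike.re (inner 𝕜 u ((toCLM A - toCLM B) u)) ≤ ‖toCLM A - toCLM B‖ * ‖u‖ ^ 2 := by
    refine (RCLike.re_le_norm _).trans ((norm_inner_le_norm _ _).trans ?_)
    have := (toCLM A - toCLM B).le_opNorm u
    nlinarith [norm_nonneg u]
  rw [sub_apply, inner_sub_right, map_sub] at hAB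
  rw [hu] at hA hB hAB
  linarith

theorem continuous_eigval (k : Fin n) : Continuous fun A : SymMat 𝕜 n => A.eigval k := by
  refine continuous_iff_continuousAt.2 fun A => ?_
  refine tendsto_iff_dist_tendsto_zero.2 (squeeze_zero (g := fun B => ‖toCLM B - toCLM A‖)
    (fun _ => dist_nonneg) (fun B => ?_) ?_)
  · have h1 := eigval_le_eigval_add_norm A B k
    have h2 := eigval_le_eigval_add_norm B A k
    rw [norm_sub_rev] at h1
    rw [Real.dist_eq, abs_le]
    constructor <;> linarith
  · have : Continuous fun B : SymMat 𝕜 n => ‖toCLM B - toCLM A‖ :=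
      (continuous_toCLM.sub continuous_const).norm
    simpa using this.tendsto A

theorem abs_eigval_le (A : SymMat 𝕜 n) (i : Fin n) : |A.eigval i| ≤ ‖toCLM A‖ := by
  obtain ⟨e, he⟩ := A.exists_eigenbasis
  have := (toCLM A).le_opNorm (e i)
  simpa [he, norm_smul] using this

/-- A quantitative monotonicity of the `k`-th eigenvalue: it suffices that the perturbation is
positive up to a multiple of `(A - λ)²`. -/
theorem eigval_add_smul_ge {A B : SymMat 𝕜 n} {k : Fin n} {K c t : ℝ} (hK : 0 ≤ K) (ht : 0 ≤ t)
    (htK : t * K * (2 * ‖toCLM A‖) ≤ 1)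
    (h : ∀ u : EuclideanSpace 𝕜 (Fin n), ‖u‖ = 1 → c ≤
      RCLike.re (inner 𝕜 u (toCLM B u)) + K * ‖toCLM A u - (A.eigval k : 𝕜) • u‖ ^ 2) :
    A.eigval k + c * t ≤ (A + t • B).eigval k := by
  obtain ⟨e, he⟩ := A.exists_eigenbasis
  obtain ⟨e', he'⟩ := (A + t • B).exists_eigenbasis
  obtain ⟨u, hu, h1, h2⟩ := exists_norm_eq_one_of_bases e e' k
  -- Only indices `i ≥ k` contribute. There the gap `λ_i - λ_k` lies in `[0, 2‖A‖]`, so `tK (λ_i -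
  -- λ_k)² ≤ λ_i - λ_k`: the spectral gap pays for the penalty term.
  have hA : t * K * ‖toCLM A u - (A.eigval k : 𝕜) • u‖ ^ 2 ≤
      RCLike.re (inner 𝕜 u (toCLM A u)) - A.eigval k * ‖u‖ ^ 2 := by
    rw [re_inner_toCLM_sub he, norm_toCLM_sub_sq he, Finset.mul_sum]
    refine Finset.sum_le_sum fun i _ => ?_
    rcases lt_or_ge i k with hik | hik
    · simp [h1 i hik]
    · rw [← mul_assoc]
      refine mul_le_mul_of_nonneg_right ?_ (sq_nonneg _)
      have h3 := sub_nonneg.2 (A.eigval_mono hik)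
      have h4 : A.eigval i - A.eigval k ≤ 2 * ‖toCLM A‖ := by
        have := abs_le.1 (A.abs_eigval_le i)
        have := abs_le.1 (A.abs_eigval_le k)
        linarith
      have h5 := mul_le_mul_of_nonneg_left h4 (mul_nonneg ht hK)
      nlinarith
  have hB : RCLike.re (inner 𝕜 u (toCLM (A + t • B) u)) - (A + t • B).eigval k * ‖u‖ ^ 2 ≤ 0 := by
    rw [re_inner_toCLM_sub he']
    refine Finset.sum_nonpos fun i _ => ?_
    rcases lt_or_ge k i with h | h
    · simp [h2 i h]
    · exact mul_nonpos_of_nonpos_of_nonneg (sub_nonpos.2 ((A + t • B).eigval_mono h)) (sq_nonneg _)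
  have hAB : RCLike.re (inner 𝕜 u (toCLM (A + t • B) u)) =
      RCLike.re (inner 𝕜 u (toCLM A u)) + t * RCLike.re (inner 𝕜 u (toCLM B u)) := by
    rw [map_add, map_smul, add_apply, smul_apply,
      inner_add_right, map_add, RCLike.real_smul_eq_coe_smul (K := 𝕜), inner_smul_right,
      RCLike.re_ofReal_mul]
  have h6 := mul_le_mul_of_nonneg_left (h u hu) ht
  rw [hu] at hA hB
  linarith

theorem continuous_norm_toCLM : Continuous fun A : SymMat 𝕜 n => ‖toCLM A‖ :=
  continuous_toCLM.norm

theorem eventually_norm_toCLM_lt (A₀ : SymMat 𝕜 n) :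
    ∀ᶠ A in 𝓝 A₀, ‖toCLM A‖ < ‖toCLM A₀‖ + 1 :=
  (continuous_norm_toCLM.tendsto A₀).eventually (gt_mem_nhds (lt_add_one _))

section Continuity

variable {X : Type*} [TopologicalSpace X] {f : X → SymMat 𝕜 n} {g : X → EuclideanSpace 𝕜 (Fin n)}

theorem continuous_toCLM_apply (hf : Continuous f) (hg : Continuous g) :
    Continuous fun x => toCLM (f x) (g x) :=
  (continuous_toCLM.comp hf).clm_apply hg

theorem continuous_re_inner_toCLM (hf : Continuous f) (hg : Continuous g) :
    Continuous fun x => RCLike.re (inner 𝕜 (g x) (toCLM (f x) (g x))) :=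
  RCLike.continuous_re.comp (hg.inner (continuous_toCLM_apply hf hg))

theorem continuous_norm_toCLM_sub_sq (k : Fin n) (hf : Continuous f) (hg : Continuous g) :
    Continuous fun x => ‖toCLM (f x) (g x) - ((f x).eigval k : 𝕜) • g x‖ ^ 2 := by
  have h1 : Continuous fun x => ((f x).eigval k : 𝕜) :=
    RCLike.continuous_ofReal.comp ((continuous_eigval k).comp hf)
  have h2 : Continuous fun x => toCLM (f x) (g x) - ((f x).eigval k : 𝕜) • g x :=
    (continuous_toCLM_apply hf hg).sub (h1.smul hg)
  exact h2.norm.pow 2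

end Continuity

/-- If `B` is positive on the eigenspace of `A₀`, then the `k`-th eigenvalue increases at a definite
rate in all directions near `B`, at all matrices near `A₀`. -/
theorem eventually_eigval_add_smul_ge {A₀ B₀ : SymMat 𝕜 n} {k : Fin n}
    (hB : ∀ u ∈ A₀.eigspace k, u ≠ 0 → 0 < RCLike.re (inner 𝕜 u (toCLM B₀ u))) :
    ∃ c > 0, ∃ t₀ > 0, ∀ᶠ p : SymMat 𝕜 n × SymMat 𝕜 n in 𝓝 (A₀, B₀), ∀ t, 0 ≤ t → t ≤ t₀ →
      p.1.eigval k + c * t ≤ (p.1 + t • p.2).eigval k := by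
  have h1 : Continuous fun q : (SymMat 𝕜 n × SymMat 𝕜 n) × EuclideanSpace 𝕜 (Fin n) =>
      RCLike.re (inner 𝕜 q.2 (toCLM q.1.2 q.2)) :=
    continuous_re_inner_toCLM (continuous_snd.comp continuous_fst) continuous_snd
  have h2 : Continuous fun q : (SymMat 𝕜 n × SymMat 𝕜 n) × EuclideanSpace 𝕜 (Fin n) =>
      ‖toCLM q.1.1 q.2 - (q.1.1.eigval k : 𝕜) • q.2‖ ^ 2 :=
    continuous_norm_toCLM_sub_sq k (continuous_fst.comp continuous_fst) continuous_snd
  -- The zeros of `‖(A₀ - λ_k) u‖²` on the unit sphere are the unit eigenvectors, where `hB`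
  -- applies.
  obtain ⟨K, c, hc, hev⟩ := (isCompact_sphere (0 : EuclideanSpace 𝕜 (Fin n)) 1).exists_nat_forall_lt
    h1 h2 (A₀, B₀) (fun u _ => sq_nonneg _)
    (fun u hu h0 => hB u (mem_eigspace.2 (by simpa [sub_eq_zero] using h0))
      (by rintro rfl; simp at hu))
  obtain ⟨R, hR, hbd⟩ : ∃ R > 0, ∀ᶠ A in 𝓝 A₀, ‖toCLM A‖ < R :=
    ⟨‖toCLM A₀‖ + 1, add_pos_of_nonneg_of_pos (norm_nonneg _) one_pos, eventually_norm_toCLM_lt A₀⟩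
  -- `K + 1` replaces `K` because `K` may be `0`.
  have hden : 0 < (K + 1 : ℝ) * (2 * R) := by positivity
  refine ⟨c, hc, ((K + 1 : ℝ) * (2 * R))⁻¹, inv_pos.2 hden, ?_⟩
  filter_upwards [hev, (continuous_fst.tendsto (A₀, B₀)).eventually hbd] with p hp hpb t ht ht'
  refine eigval_add_smul_ge (K := K) (Nat.cast_nonneg _) ht ?_
    fun u hu => (hp u (mem_sphere_zero_iff_norm.2 hu)).le
  have h3 : (K : ℝ) * (2 * ‖toCLM p.1‖) ≤ (K + 1) * (2 * R) :=
    mul_le_mul (by linarith) (by linarith) (by positivity) (by positivity)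
  rw [mul_assoc]
  calc t * (K * (2 * ‖toCLM p.1‖)) ≤ ((K + 1 : ℝ) * (2 * R))⁻¹ * ((K + 1 : ℝ) * (2 * R)) :=
        mul_le_mul ht' h3 (by positivity) (by positivity)
    _ = 1 := inv_mul_cancel₀ hden.ne'

end SymMat

end

/-! ### The positive definite cone and Frobenius duality -/

noncomputable section

namespace SymMat

variable {𝕜 : Type*} [RCLike 𝕜] {n : ℕ}

theorem re_inner_toCLM (A : SymMat 𝕜 n) (u : EuclideanSpace 𝕜 (Fin n)) :
    RCLike.re (inner 𝕜 u (toCLM A u)) =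
      RCLike.re (star u.ofLp ⬝ᵥ (toMat A *ᵥ u.ofLp)) := by
  rw [EuclideanSpace.inner_eq_star_dotProduct, dotProduct_comm]
  rfl

theorem star_dotProduct_mulVec_eq (A : SymMat 𝕜 n) (u : Fin n → 𝕜) :
    star u ⬝ᵥ (toMat A *ᵥ u) = (RCLike.re (star u ⬝ᵥ (toMat A *ᵥ u)) : 𝕜) := by
  refine RCLike.ext (by simp) ?_
  rw [A.isHermitian.im_star_dotProduct_mulVec_self, RCLike.ofReal_im]

theorem posDef_iff {A : SymMat 𝕜 n} : (toMat A).PosDef ↔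
    ∀ u : EuclideanSpace 𝕜 (Fin n), u ≠ 0 → 0 < RCLike.re (inner 𝕜 u (toCLM A u)) := by
  refine ⟨fun h u hu => ?_, fun h => .of_dotProduct_mulVec_pos A.isHermitian fun u hu => ?_⟩
  · rw [re_inner_toCLM]
    exact h.re_dotProduct_pos fun h0 => hu (by ext i; exact congrFun h0 i)
  · have := h (WithLp.toLp 2 u) (by simpa using hu)
    rw [re_inner_toCLM] at this
    rw [star_dotProduct_mulVec_eq]
    exact RCLike.ofReal_pos.2 this

theorem posSemidef_of_re_nonneg {A : SymMat 𝕜 n}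
    (h : ∀ u : Fin n → 𝕜, 0 ≤ RCLike.re (star u ⬝ᵥ (toMat A *ᵥ u))) : (toMat A).PosSemidef := by
  refine .of_dotProduct_mulVec_nonneg A.isHermitian fun u => ?_
  rw [star_dotProduct_mulVec_eq]
  exact RCLike.ofReal_nonneg.2 (h u)

theorem isOpen_posDef : IsOpen {A : SymMat 𝕜 n | (toMat A).PosDef} := by
  refine isOpen_iff_mem_nhds.2 fun A hA => ?_
  have hev : ∀ᶠ B in 𝓝 A, ∀ u ∈ Metric.sphere (0 : EuclideanSpace 𝕜 (Fin n)) 1,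
      0 < RCLike.re (inner 𝕜 u (toCLM B u)) :=
    (isCompact_sphere _ _).eventually_forall_of_forall_eventually fun u hu =>
      (continuous_re_inner_toCLM continuous_fst continuous_snd).continuousAt.eventually
        (lt_mem_nhds (posDef_iff.1 hA u (by rintro rfl; simp at hu)))
  filter_upwards [hev] with B hB
  refine posDef_iff.2 fun u hu => ?_
  have h1 := hB ((‖u‖⁻¹ : 𝕜) • u) (mem_sphere_zero_iff_norm.2 (norm_smul_inv_norm hu))
  have h2 : (‖u‖⁻¹ : 𝕜) = ((‖u‖⁻¹ : ℝ) : 𝕜) := by simp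
  rw [map_smul, inner_smul_left, inner_smul_right, h2, RCLike.conj_ofReal, RCLike.re_ofReal_mul,
    RCLike.re_ofReal_mul] at h1
  have h3 : 0 < ‖u‖⁻¹ := inv_pos.2 (norm_pos_iff.2 hu)
  exact (mul_pos_iff_of_pos_left h3).1 ((mul_pos_iff_of_pos_left h3).1 h1)

theorem convex_posDef : Convex ℝ {A : SymMat 𝕜 n | (toMat A).PosDef} := by
  refine convex_iff_forall_pos.2 fun A hA B hB a b ha hb _ => posDef_iff.2 fun u hu => ?_
  have h1 := mul_pos ha (posDef_iff.1 hA u hu)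
  have h2 := mul_pos hb (posDef_iff.1 hB u hu)
  rw [map_add, map_smul, map_smul, add_apply, smul_apply, smul_apply, inner_add_right, map_add,
    RCLike.real_smul_eq_coe_smul (K := 𝕜), RCLike.real_smul_eq_coe_smul (K := 𝕜), inner_smul_right,
    inner_smul_right, RCLike.re_ofReal_mul, RCLike.re_ofReal_mul]
  exact add_pos h1 h2

theorem toCLM_injective : Function.Injective (toCLM : SymMat 𝕜 n → _) := fun _ _ h =>
  toMat_injective (Matrix.toEuclideanLin.injective (LinearMap.toContinuousLinearMap.injective h))

theorem frobInner_eq_sum {X Y : SymMat 𝕜 n}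
    {e : OrthonormalBasis (Fin n) 𝕜 (EuclideanSpace 𝕜 (Fin n))}
    (he : ∀ i, toCLM Y (e i) = (Y.eigval i : 𝕜) • e i) :
    frobInner X Y = ∑ i, Y.eigval i * RCLike.re (inner 𝕜 (e i) (toCLM X (e i))) := by
  have h1 : Matrix.trace (toMat X * toMat Y) =
      LinearMap.trace 𝕜 _ (Matrix.toEuclideanLin (toMat X * toMat Y)) := by
    rw [Matrix.toEuclideanLin, Matrix.toLpLin_eq_toLin, Matrix.trace_toLin_eq]
  rw [frobInner, h1, LinearMap.trace_eq_sum_inner _ e, map_sum]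
  refine Finset.sum_congr rfl fun i _ => ?_
  have h2 : Matrix.toEuclideanLin (toMat X * toMat Y) (e i) = toCLM X (toCLM Y (e i)) := by
    simp [toCLM_apply]
  rw [h2, he, map_smul, inner_smul_right, RCLike.re_ofReal_mul]

/-- In an eigenbasis of `Y` the trace is a sum of the eigenvalues of `Y`, all nonnegative, with the
strictly positive weights `⟨e i, C (e i)⟩`; if it vanishes, so does each eigenvalue. -/
theorem eq_zero_of_frobInner_eq_zero {C Y : SymMat 𝕜 n} (hC : (toMat C).PosDef)
    (hY : (toMat Y).PosSemidef) (h : frobInner C Y = 0) : Y = 0 := by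
  obtain ⟨e, he⟩ := Y.exists_eigenbasis
  have hpos (i : Fin n) : 0 < RCLike.re (inner 𝕜 (e i) (toCLM C (e i))) :=
    posDef_iff.1 hC _ (e.orthonormal.ne_zero i)
  have hnn (i : Fin n) : 0 ≤ Y.eigval i := by
    have := hY.re_dotProduct_nonneg (e i).ofLp
    rw [← re_inner_toCLM, he, inner_smul_right, RCLike.re_ofReal_mul] at this
    simpa [e.orthonormal.norm_eq_one] using this
  rw [frobInner_eq_sum he, Finset.sum_eq_zero_iff_of_nonneg
    fun i _ => mul_nonneg (hnn i) (hpos i).le] at h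
  refine toCLM_injective (ContinuousLinearMap.coe_injective (e.toBasis.ext fun i => ?_))
  have : Y.eigval i = 0 := (mul_eq_zero.1 (h i (Finset.mem_univ i))).resolve_right (hpos i).ne'
  simp [he, this]

/-- Every linear functional on `Sym_n` is represented by the Frobenius inner product. -/
theorem exists_frobInner_eq (f : SymMat 𝕜 n →ₗ[ℝ] ℝ) :
    ∃ Y : SymMat 𝕜 n, ∀ X, frobInner X Y = f X := by
  let B : SymMat 𝕜 n →ₗ[ℝ] Module.Dual ℝ (SymMat 𝕜 n) := LinearMap.mk₂ ℝ (fun Y X => frobInner X Y)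
    (fun _ _ _ => by simp [frobInner, Matrix.mul_add])
    (fun _ _ _ => by simp [frobInner, RCLike.smul_re])
    (fun _ _ _ => by simp [frobInner, Matrix.add_mul])
    (fun _ _ _ => by simp [frobInner, RCLike.smul_re])
  -- `Tr (Y Y)` is the sum of the squared eigenvalues; in finite dimension injectivity into the dual
  -- gives surjectivity.
  have hB : Function.Injective B := by
    refine (injective_iff_map_eq_zero B).2 fun Y hY => ?_
    obtain ⟨e, he⟩ := Y.exists_eigenbasis
    have h1 : frobInner Y Y = 0 := LinearMap.congr_fun hY Y
    have h2 (i : Fin n) : RCLike.re (inner 𝕜 (e i) (toCLM Y (e i))) = Y.eigval i := by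
      rw [he, inner_smul_right, RCLike.re_ofReal_mul]
      simp [e.orthonormal.norm_eq_one]
    simp only [frobInner_eq_sum he, h2] at h1
    rw [Finset.sum_eq_zero_iff_of_nonneg fun i _ => mul_self_nonneg _] at h1
    refine toCLM_injective (ContinuousLinearMap.coe_injective (e.toBasis.ext fun i => ?_))
    have : Y.eigval i = 0 := mul_self_eq_zero.1 (h1 i (Finset.mem_univ i))
    simp [he, this]
  obtain ⟨Y, hY⟩ := (LinearMap.injective_iff_surjective_of_finrank_eq_finrank
    Subspace.dual_finrank_eq.symm).1 hB f
  exact ⟨Y, fun X => LinearMap.congr_fun hY X⟩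

/-- A subspace of `Sym_n` contains a positive definite matrix if and only if its
orthogonal complement meets the cone of positive semidefinite matrices only in `0`. -/
theorem exists_posDef_iff (S : Submodule ℝ (SymMat 𝕜 n)) :
    (∃ C ∈ S, (toMat C).PosDef) ↔ perp S ∩ psdCone 𝕜 n = {0} := by
  constructor
  · rintro ⟨C, hCS, hC⟩
    refine Set.eq_singleton_iff_unique_mem.2 ⟨⟨fun X _ => ?_, ?_⟩, ?_⟩
    · simp [frobInner]
    · simpa [psdCone] using Matrix.PosSemidef.zero
    · rintro Y ⟨hYS, hY⟩
      exact eq_zero_of_frobInner_eq_zero hC hY (hYS C hCS)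
  · intro h
    by_contra! hS
    obtain ⟨f, c, hfc, hcf⟩ := geometric_hahn_banach_open convex_posDef isOpen_posDef S.convex
      (Set.disjoint_left.2 fun C hC hCS => hS C hCS hC)
    have hc0 : c ≤ 0 := by simpa using hcf 0 S.zero_mem
    -- A linear functional bounded below on a subspace vanishes there: otherwise some multiple of
    -- `X` has the value `c - 1`.
    have hf0 : ∀ X ∈ S, f X = 0 := fun X hX => by
      by_contra hne
      have := hcf (((c - 1) / f X) • X) (S.smul_mem _ hX)
      rw [map_smul, smul_eq_mul, div_mul_cancel₀ _ hne] at this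
      linarith
    obtain ⟨Y, hY⟩ := exists_frobInner_eq (-f.toLinearMap)
    obtain ⟨J, hJ⟩ : ∃ J : SymMat 𝕜 n, (toMat J).PosDef :=
      ⟨⟨1, Matrix.isHermitian_one⟩, Matrix.PosDef.one⟩
    have h1 := hfc J hJ
    have hYpsd : Y ∈ psdCone 𝕜 n := by
      -- Test against the rank-one matrix `R = u u*`. It is only semidefinite, so a multiple of `J`
      -- is added, scaled to change `f` by exactly `-ε`.
      refine posSemidef_of_re_nonneg fun u => ?_
      let R : SymMat 𝕜 n := ⟨Matrix.vecMulVec u (star u),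
        (Matrix.posSemidef_vecMulVec_self_star u).isHermitian⟩
      have hR : frobInner R Y = RCLike.re (star u ⬝ᵥ (toMat Y *ᵥ u)) := by
        have : toMat R = Matrix.vecMulVec u (star u) := rfl
        rw [frobInner, this, Matrix.vecMulVec_mul, Matrix.trace_vecMulVec, dotProduct_comm,
          Matrix.dotProduct_mulVec]
      rw [← hR, hY]
      refine le_of_forall_pos_le_add fun ε hε => ?_
      have hδ : 0 < ε / -f J := div_pos hε (by linarith)
      have hpos : (toMat (R + (ε / -f J) • J)).PosDef := by
        rw [map_add, map_smul]
        exact Matrix.PosDef.posSemidef_add (Matrix.posSemidef_vecMulVec_self_star u) (hJ.smul hδ)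
      have h2 := hfc _ hpos
      rw [map_add, map_smul, smul_eq_mul, div_mul_eq_mul_div, mul_div_assoc, div_neg,
        div_self (by linarith)] at h2
      rw [LinearMap.neg_apply, ContinuousLinearMap.coe_coe]
      linarith
    have hY0 : Y = 0 := by
      have : Y ∈ perp S ∩ psdCone 𝕜 n := ⟨fun X hX => by simp [hY, hf0 X hX], hYpsd⟩
      simpa [h] using this
    have h2 := hY J
    rw [hY0, frobInner, map_zero, mul_zero, Matrix.trace_zero, map_zero, LinearMap.neg_apply,
      ContinuousLinearMap.coe_coe] at h2
    linarith

end SymMat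

end

/-! ### Topological regularity from growth in one direction -/

section StrongDeformationRetract

variable {X : Type*} [TopologicalSpace X] {A B : Set X}

theorem IsStrongDeformationRetract.of_homotopy (hAB : A ⊆ B) (H : unitInterval × B → X)
    (hH : Continuous H) (hB : ∀ p, H p ∈ B) (h0 : ∀ y, H (0, y) = y) (h1 : ∀ y, H (1, y) ∈ A)
    (hA : ∀ t (y : B), (y : X) ∈ A → H (t, y) = y) : IsStrongDeformationRetract A B := by
  refine ⟨hAB, ⟨fun y => ⟨H (1, y), hB _⟩, by fun_prop⟩, h1, ⟨⟨⟨⟨fun p => ⟨H p, hB p⟩, by fun_prop⟩,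
    fun y => Subtype.ext (h0 y), fun y => rfl⟩, fun t y hy => Subtype.ext (hA t y hy)⟩⟩⟩

end StrongDeformationRetract

theorem IsTopologicallyRegular.of_openPartialHomeomorph {d : ℕ} {M : Type*} [TopologicalSpace M]
    {φ : M → ℝ} {x : M} (e : OpenPartialHomeomorph M (EuclideanSpace ℝ (Fin d)))
    (hx : x ∈ e.source) (h : IsTopologicallyRegular d (φ ∘ e.symm) (e x)) :
    IsTopologicallyRegular d φ x := by
  intro W hW
  have hex : e x ∈ e.target := e.map_source hx
  obtain ⟨U, hUW, hUo, hxU, ⟨u⟩, ε₀, hε₀, hε⟩ := h (e.target ∩ e.symm ⁻¹' W)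
    -- Shrinking into `e.target` lets the whole homotopy be conjugated by `e`.
    (Filter.inter_mem (e.open_target.mem_nhds hex)
      ((e.symm.continuousAt hex).preimage_mem_nhds (by rwa [e.left_inv hx])))
  have hUt : U ⊆ e.target := fun y hy => (hUW hy).1
  have himage : e '' (e.source ∩ e ⁻¹' U) = U := by
    rw [e.image_source_inter_eq']
    ext y
    refine ⟨fun hy => by simpa [e.right_inv hy.1] using hy.2, fun hy => ⟨hUt hy, ?_⟩⟩
    simpa [e.right_inv (hUt hy)] using hy
  refine ⟨e.source ∩ e ⁻¹' U, fun y hy => ?_, e.isOpen_inter_preimage hUo, ⟨hx, hxU⟩,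
    ⟨(e.homeomorphOfImageSubsetSource Set.inter_subset_left himage).trans u⟩, ε₀, hε₀,
    fun ε hε0 hεε₀ => ?_⟩
  · have := (hUW hy.2).2
    rwa [Set.mem_preimage, e.left_inv hy.1] at this
  have hto (s : ℝ) (y : M) (hy : y ∈ localSublevel φ x (e.source ∩ e ⁻¹' U) s) :
      e y ∈ localSublevel (φ ∘ e.symm) (e x) U s := by
    refine ⟨hy.1.2, ?_⟩
    simpa [e.left_inv hy.1.1, e.left_inv hx] using hy.2
  have hfrom (s : ℝ) (y) (hy : y ∈ localSublevel (φ ∘ e.symm) (e x) U s) :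
      e.symm y ∈ localSublevel φ x (e.source ∩ e ⁻¹' U) s := by
    refine ⟨⟨e.map_target (hUt hy.1), ?_⟩, ?_⟩
    · simpa [e.right_inv (hUt hy.1)] using hy.1
    · simpa [e.left_inv hx] using hy.2
  obtain ⟨hAB, r, hr, ⟨G⟩⟩ := hε ε hε0 hεε₀
  refine .of_homotopy (fun y hy => ⟨hy.1, hy.2.trans (by linarith)⟩)
    (fun p => e.symm (G (p.1, ⟨e p.2, hto ε _ p.2.2⟩))) ?_ (fun p => hfrom ε _ (Subtype.prop _))
    (fun y => ?_) (fun y => ?_) (fun t y hy => ?_)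
  · refine e.continuousOn_symm.comp_continuous ?_ fun p => hUt (Subtype.prop (G _)).1
    refine continuous_subtype_val.comp (G.continuous.comp (continuous_fst.prodMk
      (Continuous.subtype_mk ?_ _)))
    exact e.continuousOn.comp_continuous (continuous_subtype_val.comp continuous_snd)
      fun p => p.2.2.1.1
  · simp [e.left_inv y.2.1.1]
  · simpa using hfrom _ _ (hr _)
  · have := G.eq_fst t (x := ⟨e y, hto ε _ y.2⟩) (hto _ _ hy)
    simp [this, e.left_inv y.2.1.1]

/-- A bounded open convex nonempty set in a real normed space is homeomorphic to the unit ball. -/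
theorem nonempty_homeomorph_ball_of_convex {E : Type*} [NormedAddCommGroup E] [NormedSpace ℝ E]
    {U : Set E} (hc : Convex ℝ U) (ho : IsOpen U) (hne : U.Nonempty) (hb : Bornology.IsBounded U) :
    Nonempty (U ≃ₜ Metric.ball (0 : E) 1) := by
  obtain ⟨h, hU, -⟩ := exists_homeomorph_image_interior_closure_frontier_eq_unitBall hc
    (by rwa [ho.interior_eq]) hb
  rw [ho.interior_eq] at hU
  exact ⟨(h.image U).trans (Homeomorph.setCongr hU)⟩

/-- A continuous function that increases at a definite rate along all segments in a fixed direction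
`w` near `0` is topologically regular at `0`. -/
theorem isTopologicallyRegular_of_increasing {d : ℕ} {ψ : EuclideanSpace ℝ (Fin d) → ℝ}
    {w : EuclideanSpace ℝ (Fin d)} {c t₀ : ℝ} {N : Set (EuclideanSpace ℝ (Fin d))}
    (hw : w ≠ 0) (hc : 0 < c) (ht₀ : 0 < t₀) (hN : N ∈ 𝓝 0) (hψ : ContinuousOn ψ N)
    (hinc : ∀ y ∈ N, ∀ t, 0 ≤ t → t ≤ t₀ → y + t • w ∈ N → ψ y + c * t ≤ ψ (y + t • w)) :
    IsTopologicallyRegular d ψ 0 := by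
  intro W hW
  -- `l w = 1` gives coordinates `y = P y + l y • w`: a transverse part and a height.
  obtain ⟨l, hl⟩ := SeparatingDual.exists_eq_one (R := ℝ) hw
  obtain ⟨η, hη, hηN⟩ := Metric.mem_nhds_iff.1 (Filter.inter_mem hN hW)
  -- Heights range over `[-δ, δ]`, so steps have length at most `2 * δ`; the second bound keeps the
  -- tube inside the ball of radius `η`.
  obtain ⟨δ, hδ, hδt, hδw⟩ : ∃ δ > 0, 2 * δ ≤ t₀ ∧ δ * ‖w‖ < η / 2 := by
    refine ⟨min (t₀ / 2) (η / 4 / ‖w‖), by positivity, ?_, ?_⟩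
    · linarith [min_le_left (t₀ / 2) (η / 4 / ‖w‖)]
    · have hw' : 0 < ‖w‖ := norm_pos_iff.2 hw
      calc min (t₀ / 2) (η / 4 / ‖w‖) * ‖w‖ ≤ η / 4 / ‖w‖ * ‖w‖ := by gcongr; exact min_le_right _ _
        _ = η / 4 := div_mul_cancel₀ _ hw'.ne'
        _ < η / 2 := by linarith
  have hball : ∀ z : EuclideanSpace ℝ (Fin d), ‖z‖ < η / 2 → ∀ s : ℝ, |s| ≤ δ →
      z + s • w ∈ Metric.ball (0 : EuclideanSpace ℝ (Fin d)) η := fun z hz s hs => by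
    rw [mem_ball_zero_iff]
    have h1 := norm_add_le z (s • w)
    rw [norm_smul, Real.norm_eq_abs] at h1
    have h2 := mul_le_mul_of_nonneg_right hs (norm_nonneg w)
    linarith
  have hmono : ∀ z : EuclideanSpace ℝ (Fin d), ‖z‖ < η / 2 → ∀ s₁ s₂ : ℝ, -δ ≤ s₁ → s₁ ≤ s₂ →
      s₂ ≤ δ → ψ (z + s₁ • w) + c * (s₂ - s₁) ≤ ψ (z + s₂ • w) := fun z hz s₁ s₂ h1 h2 h3 => by
    have h4 : z + s₂ • w = z + s₁ • w + (s₂ - s₁) • w := by rw [sub_smul]; abel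
    have h5 := hinc (z + s₁ • w) (hηN (hball z hz s₁ (abs_le.2 ⟨h1, h2.trans h3⟩))).1 (s₂ - s₁)
      (by linarith) (by linarith)
      (by rw [← h4]; exact (hηN (hball z hz s₂ (abs_le.2 ⟨h1.trans h2, h3⟩))).1)
    rwa [← h4] at h5
  have hcont : ∀ z : EuclideanSpace ℝ (Fin d), ‖z‖ < η / 2 → ∀ s : ℝ, |s| ≤ δ →
      ContinuousAt ψ (z + s • w) := fun z hz s hs =>
    hψ.continuousAt (Filter.mem_of_superset (Metric.isOpen_ball.mem_nhds (hball z hz s hs))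
      fun y hy => (hηN hy).1)
  have h0 : ‖(0 : EuclideanSpace ℝ (Fin d))‖ < η / 2 := by simpa using half_pos hη
  have hcont' : ∀ s : ℝ, |s| ≤ δ →
      Filter.Tendsto (fun z => ψ (z + s • w)) (𝓝 0) (𝓝 (ψ (0 + s • w))) := fun s hs =>
    Filter.Tendsto.comp (hcont 0 h0 s hs)
      ((continuous_id.add continuous_const).tendsto' _ _ rfl)
  have hδδ : |δ| ≤ δ := (abs_of_pos hδ).le
  have hδδ' : |-δ| ≤ δ := by rw [abs_neg]; exact hδδ
  -- On the axis the ends of the tube differ from level `ψ 0` by at least `c * δ`; half of this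
  -- margin survives for nearby `z`.
  have hlow : ∀ᶠ z in 𝓝 (0 : EuclideanSpace ℝ (Fin d)), ψ (z + (-δ) • w) < ψ 0 - c * δ / 2 := by
    refine (hcont' (-δ) hδδ').eventually (gt_mem_nhds ?_)
    have := hmono 0 h0 (-δ) 0 le_rfl (by linarith) hδ.le
    rw [zero_smul, add_zero] at this
    nlinarith
  have hhigh : ∀ᶠ z in 𝓝 (0 : EuclideanSpace ℝ (Fin d)), ψ 0 + c * δ / 2 < ψ (z + δ • w) := by
    refine (hcont' δ hδδ).eventually (lt_mem_nhds ?_)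
    have := hmono 0 h0 0 δ (by linarith) hδ.le le_rfl
    rw [zero_smul, add_zero] at this
    nlinarith
  obtain ⟨r', hr', hr'z⟩ := Metric.eventually_nhds_iff.1 (hlow.and hhigh)
  obtain ⟨r, hr, hrη, hrr'⟩ : ∃ r > 0, r ≤ η / 2 ∧ r ≤ r' :=
    ⟨min (η / 2) r', by positivity, min_le_left _ _, min_le_right _ _⟩
  let P : EuclideanSpace ℝ (Fin d) →L[ℝ] EuclideanSpace ℝ (Fin d) :=
    ContinuousLinearMap.id ℝ _ - l.smulRight w
  have hP : ∀ y, P y = y - l y • w := fun y => rfl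
  have hPy : ∀ y, P y + l y • w = y := fun y => by rw [hP, sub_add_cancel]
  have hPs : ∀ y (s : ℝ), P (P y + s • w) = P y := fun y s => by
    simp only [hP, map_add, map_sub, map_smul, hl, smul_eq_mul, mul_one]
    simp
  have hls : ∀ y (s : ℝ), l (P y + s • w) = s := fun y s => by
    simp [hP, hl]
  let U : Set (EuclideanSpace ℝ (Fin d)) := P ⁻¹' Metric.ball 0 r ∩ l ⁻¹' Set.Ioo (-δ) δ
  have hUP : ∀ y ∈ U, ‖P y‖ < r := fun y hy => mem_ball_zero_iff.1 hy.1
  have hUη : ∀ y ∈ U, ‖P y‖ < η / 2 := fun y hy => (hUP y hy).trans_le hrη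
  have hUball : U ⊆ Metric.ball 0 η := fun y hy => by
    have := hball (P y) (hUη y hy) (l y) (abs_le.2 ⟨hy.2.1.le, hy.2.2.le⟩)
    rwa [hPy] at this
  have hUo : IsOpen U := (Metric.isOpen_ball.preimage P.continuous).inter
    (isOpen_Ioo.preimage l.continuous)
  have hU0 : (0 : EuclideanSpace ℝ (Fin d)) ∈ U := by simp [U, hr, hδ]
  have hUc : Convex ℝ U := ((convex_ball 0 r).linear_preimage P.toLinearMap).inter
    ((convex_Ioo (-δ) δ).linear_preimage l.toLinearMap)
  refine ⟨U, fun y hy => (hηN (hUball hy)).2, hUo, hU0,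
    nonempty_homeomorph_ball_of_convex hUc hUo ⟨0, hU0⟩ (Metric.isBounded_ball.subset hUball),
    c * δ / 2, by positivity, fun ε hε hεδ => ?_⟩
  -- Since `ε ≤ c * δ / 2`, the level `ψ 0 - ε` is crossed strictly inside every segment; `g y` is
  -- the height of the crossing.
  have hex : ∀ y ∈ U, ∃ s : ℝ, (-δ < s ∧ s < δ) ∧ ψ (P y + s • w) = ψ 0 + -ε := fun y hy => by
    have h1 := hr'z (y := P y) (by rw [dist_zero_right]; exact (hUP y hy).trans_le hrr')
    refine intermediate_value_Ioo (f := fun s : ℝ => ψ (P y + s • w)) (by linarith) (fun s hs => ?_)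
      ⟨by linarith [h1.1], by linarith [h1.2]⟩
    refine ContinuousAt.continuousWithinAt (ContinuousAt.comp (f := fun s : ℝ => P y + s • w)
      (hcont _ (hUη y hy) s (abs_le.2 hs)) ?_)
    fun_prop
  choose! g hg hga using hex
  -- At a fixed height `b ≠ g y`, `ψ` differs strictly from the level. This persists for nearby base
  -- points, and monotonicity along `w` then keeps the crossing on the same side of `b`.
  have hgcont : ContinuousOn g U := fun y hy => by
    have key : ∀ b : ℝ, |b| ≤ δ → ContinuousAt (fun y => ψ (P y + b • w)) y := fun b hb =>
      ContinuousAt.comp (f := fun y => P y + b • w) (hcont _ (hUη y hy) b hb) (by fun_prop)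
    refine tendsto_order.2 ⟨fun b hb => ?_, fun b hb => ?_⟩
    · rcases lt_or_ge b (-δ) with hbδ | hbδ
      · filter_upwards [self_mem_nhdsWithin] with z hz
        exact hbδ.trans (hg z hz).1
      · have hbδ' : b ≤ δ := hb.le.trans (hg y hy).2.le
        have h1 := hmono _ (hUη y hy) b (g y) hbδ hb.le (hg y hy).2.le
        rw [hga y hy] at h1
        have h2 : ψ (P y + b • w) < ψ 0 + -ε := by nlinarith
        filter_upwards [self_mem_nhdsWithin,
          ((key b (abs_le.2 ⟨hbδ, hbδ'⟩)).eventually (gt_mem_nhds h2)).filter_mono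
            nhdsWithin_le_nhds] with z hz hzb
        by_contra! hle
        have h3 := hmono _ (hUη z hz) (g z) b (hg z hz).1.le hle hbδ'
        rw [hga z hz] at h3
        nlinarith
    · rcases lt_or_ge δ b with hbδ | hbδ
      · filter_upwards [self_mem_nhdsWithin] with z hz
        exact (hg z hz).2.trans hbδ
      · have hbδ' : -δ ≤ b := (hg y hy).1.le.trans hb.le
        have h1 := hmono _ (hUη y hy) (g y) b (hg y hy).1.le hb.le hbδ
        rw [hga y hy] at h1
        have h2 : ψ 0 + -ε < ψ (P y + b • w) := by nlinarith
        filter_upwards [self_mem_nhdsWithin,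
          ((key b (abs_le.2 ⟨hbδ', hbδ⟩)).eventually (lt_mem_nhds h2)).filter_mono
            nhdsWithin_le_nhds] with z hz hzb
        by_contra! hle
        have h3 := hmono _ (hUη z hz) b (g z) hbδ' hle (hg z hz).2.le
        rw [hga z hz] at h3
        nlinarith
  -- The height moves linearly from `l` to `min l g`; points already at or below the graph stay
  -- fixed.
  let σ (p : unitInterval × localSublevel ψ 0 U ε) : ℝ :=
    l p.2 - p.1 * max 0 (l p.2 - g p.2)
  have hσ : Continuous σ := by
    have h1 : Continuous fun p : unitInterval × localSublevel ψ 0 U ε => g p.2 :=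
      hgcont.comp_continuous (by fun_prop) fun p => p.2.2.1
    have h2 : Continuous fun p : unitInterval × localSublevel ψ 0 U ε => l p.2 := by fun_prop
    have h3 : Continuous fun p : unitInterval × localSublevel ψ 0 U ε => (p.1 : ℝ) := by fun_prop
    exact h2.sub (h3.mul (continuous_const.max (h2.sub h1)))
  have hσle : ∀ p, σ p ≤ l p.2 := fun p => by
    have := mul_nonneg p.1.2.1 (le_max_left 0 (l p.2 - g p.2))
    simp only [σ]
    linarith
  have hσge : ∀ p, -δ < σ p := fun p => by
    have h1 := mul_le_of_le_one_left (le_max_left 0 (l p.2 - g p.2)) p.1.2.2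
    have h2 := p.2.2.1.2.1
    have h3 := (hg p.2 p.2.2.1).1
    simp only [σ]
    rcases max_cases 0 (l p.2 - g p.2) with h | h <;> linarith
  refine .of_homotopy (fun y hy => ⟨hy.1, hy.2.trans (by linarith)⟩)
    (fun p => P p.2 + σ p • w) (by fun_prop) (fun p => ⟨⟨?_, ?_⟩, ?_⟩) (fun y => ?_)
    (fun y => ⟨⟨?_, ?_⟩, ?_⟩) (fun t y hy => ?_)
  · rw [Set.mem_preimage, hPs]
    exact p.2.2.1.1
  · rw [Set.mem_preimage, hls]
    exact ⟨hσge p, (hσle p).trans_lt p.2.2.1.2.2⟩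
  · have h1 := hmono _ (hUη _ p.2.2.1) (σ p) (l p.2) (hσge p).le (hσle p) p.2.2.1.2.2.le
    rw [hPy] at h1
    have h2 := mul_nonneg hc.le (sub_nonneg.2 (hσle p))
    linarith [p.2.2.2]
  · simp [σ, hPy]
  · rw [Set.mem_preimage, hPs]
    exact y.2.1.1
  · rw [Set.mem_preimage, hls]
    exact ⟨hσge _, (hσle _).trans_lt y.2.1.2.2⟩
  · have hσg : σ (1, y) ≤ g y := by
      simp only [σ, Set.Icc.coe_one, one_mul]
      linarith [le_max_right 0 (l y - g y)]
    have h1 := hmono _ (hUη _ y.2.1) (σ (1, y)) (g y) (hσge _).le hσg (hg _ y.2.1).2.le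
    rw [hga _ y.2.1] at h1
    have h2 := mul_nonneg hc.le (sub_nonneg.2 hσg)
    linarith
  · have hle : l y ≤ g y := by
      by_contra! hlt
      have h1 := hmono _ (hUη _ y.2.1) (g y) (l y) (hg _ y.2.1).1.le hlt.le y.2.1.2.2.le
      rw [hga _ y.2.1, hPy] at h1
      have h2 := mul_pos hc (sub_pos.2 hlt)
      linarith [hy.2]
    have : σ (t, y) = l y := by
      simp only [σ]
      rw [max_eq_left (sub_nonpos.2 hle), mul_zero, sub_zero]
    simp only [this, hPy]

/-! ### Eigenvalues along a smooth map on a manifold -/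

section

variable {𝕜 : Type*} [RCLike 𝕜] {n ν d : ℕ}

/-- Writing `u = U a` turns the form of `B` at `u` into that of `U* B U` at `a`. -/
theorem SymMat.re_inner_pos_of_compression_posDef {A B : SymMat 𝕜 n} {k : Fin n}
    {U : Matrix (Fin n) (Fin ν) 𝕜} (hU : IsIsometryOnto U (A.eigspace k))
    (hB : (SymMat.toMat (SymMat.compression U B)).PosDef) :
    ∀ u ∈ A.eigspace k, u ≠ 0 → 0 < RCLike.re (inner 𝕜 u (SymMat.toCLM B u)) := by
  intro u hu hu0
  rw [← hU.2] at hu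
  obtain ⟨a, rfl⟩ := hu
  have ha : a.ofLp ≠ 0 := fun h => hu0 (by
    have : a = 0 := by ext i; exact congrFun h i
    rw [this, map_zero])
  have h1 := hB.re_dotProduct_pos ha
  rw [SymMat.re_inner_toCLM]
  have h2 : (Matrix.toEuclideanLin U a).ofLp = U *ᵥ a.ofLp := rfl
  have h3 : SymMat.toMat (SymMat.compression U B) = Uᴴ * SymMat.toMat B * U := rfl
  rw [h3, ← Matrix.mulVec_mulVec, ← Matrix.mulVec_mulVec, Matrix.dotProduct_mulVec,
    ← Matrix.star_mulVec] at h1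
  rwa [h2]

/-- Along a direction `w` in which the derivative of `f` is positive on the eigenspace, the `k`-th
eigenvalue of `f` increases at a definite rate. -/
theorem exists_eigval_increasing {E : Type*} [NormedAddCommGroup E] [NormedSpace ℝ E]
    {f : E → SymMat 𝕜 n} {f' : E →L[ℝ] SymMat 𝕜 n} {x w : E} (hf : HasStrictFDerivAt f f' x)
    {k : Fin n}
    (hB : ∀ u ∈ (f x).eigspace k, u ≠ 0 → 0 < RCLike.re (inner 𝕜 u (SymMat.toCLM (f' w) u))) :
    ∃ c > 0, ∃ t₀ > 0, ∃ N ∈ 𝓝 x, ∀ y ∈ N, ∀ t, 0 ≤ t → t ≤ t₀ → y + t • w ∈ N →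
      (f y).eigval k + c * t ≤ (f (y + t • w)).eigval k := by
  obtain ⟨c, hc, t₀, ht₀, hev⟩ := SymMat.eventually_eigval_add_smul_ge hB
  rw [nhds_prod_eq] at hev
  obtain ⟨p, hp, q, hq, hpq⟩ := Filter.eventually_prod_iff.1 hev
  obtain ⟨ρ, hρ, hqρ⟩ := Metric.eventually_nhds_iff.1 hq
  obtain ⟨κ, hκ, hκρ⟩ : ∃ κ > 0, κ * ‖w‖ < ρ := by
    refine ⟨ρ / (‖w‖ + 1), by positivity, ?_⟩
    rw [div_mul_eq_mul_div, div_lt_iff₀ (by positivity)]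
    nlinarith
  have hlittle := hf.isLittleO.def hκ
  rw [nhds_prod_eq] at hlittle
  obtain ⟨N, hN, hNκ⟩ := Filter.eventually_prod_self_iff'.1 hlittle
  refine ⟨c, hc, t₀, ht₀, N ∩ {y | p (f y)}, Filter.inter_mem hN (hf.continuousAt.eventually hp),
    fun y hy t ht htt₀ hyt => ?_⟩
  rcases ht.eq_or_lt with rfl | htpos
  · simp
  have h1 := hNκ (y + t • w) hyt.1 y hy.1
  rw [add_sub_cancel_left, map_smul, norm_smul, Real.norm_eq_abs, abs_of_pos htpos] at h1
  -- The difference quotient plays the role of the perturbing matrix; `h3` puts it within `ρ` of `f'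
  -- w`, for every `y` in `N`.
  have h2 : f (y + t • w) = f y + t • (t⁻¹ • (f (y + t • w) - f y)) := by
    rw [smul_inv_smul₀ htpos.ne', add_sub_cancel]
  have h3 : dist (t⁻¹ • (f (y + t • w) - f y)) (f' w) < ρ := by
    have h4 : t⁻¹ • (f (y + t • w) - f y) - f' w = t⁻¹ • (f (y + t • w) - f y - t • f' w) := by
      rw [smul_sub t⁻¹ (f (y + t • w) - f y), inv_smul_smul₀ htpos.ne']
    rw [dist_eq_norm, h4, norm_smul, Real.norm_eq_abs, abs_of_pos (inv_pos.2 htpos)]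
    refine lt_of_le_of_lt ?_ hκρ
    rw [inv_mul_le_iff₀ htpos]
    linarith
  have h5 := hpq hy.2 (hqρ h3) t ht htt₀
  rw [h2]
  exact h5

variable {M : Type*} [TopologicalSpace M] [ChartedSpace (EuclideanSpace ℝ (Fin d)) M]

/-- The model has no boundary, so the derivatives within its range are ordinary ones, and smoothness
makes them strict. Strictness is needed to control increments from all base points near `x`. -/
theorem ContMDiff.hasStrictFDerivAt_comp_chartAt_symm {V : Type*} [NormedAddCommGroup V]
    [NormedSpace ℝ V] [IsManifold (𝓡 d) ∞ M] {F : M → V}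
    (hF : ContMDiff (𝓡 d) 𝓘(ℝ, V) ∞ F) (x : M) :
    HasStrictFDerivAt (F ∘ (chartAt (EuclideanSpace ℝ (Fin d)) x).symm)
      (mvfderiv (𝓡 d) F x : EuclideanSpace ℝ (Fin d) →L[ℝ] V)
      (chartAt (EuclideanSpace ℝ (Fin d)) x x) := by
  have h1 : HasFDerivAt (F ∘ (chartAt (EuclideanSpace ℝ (Fin d)) x).symm)
      (mvfderiv (𝓡 d) F x : EuclideanSpace ℝ (Fin d) →L[ℝ] V)
      (chartAt (EuclideanSpace ℝ (Fin d)) x x) := by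
    have := ((hF x).mdifferentiableAt (by simp)).hasMFDerivAt.2
    rw [ModelWithCorners.range_eq_univ] at this
    exact hasFDerivWithinAt_univ.1 this
  have h2 := (contMDiffAt_iff.1 (hF x)).2
  rw [ModelWithCorners.range_eq_univ, contDiffWithinAt_univ] at h2
  exact h2.hasStrictFDerivAt' h1 (by simp)

/-- If the compressed derivative at `x` has a positive definite matrix in its range, then `x` is a
topologically regular point of the `k`-th eigenvalue. -/
theorem isTopologicallyRegular_eigval [IsManifold (𝓡 d) ∞ M]
    {F : M → SymMat 𝕜 n} (hF : ContMDiff (𝓡 d) 𝓘(ℝ, SymMat 𝕜 n) ∞ F) {k : Fin n} {x : M}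
    (hν1 : 1 ≤ ν) {U : Matrix (Fin n) (Fin ν) 𝕜} (hU : IsIsometryOnto U ((F x).eigspace k))
    (h : ∃ C ∈ LinearMap.range (compressedDeriv d F x U), (SymMat.toMat C).PosDef) :
    IsTopologicallyRegular d (fun y => (F y).eigval k) x := by
  obtain ⟨_, ⟨w, rfl⟩, hw⟩ := h
  -- Here `ν ≥ 1` matters: the empty matrix is both zero and positive definite.
  have hw0 : w ≠ 0 := by
    rintro rfl
    rw [map_zero, map_zero] at hw
    have := hw.re_dotProduct_pos (x := fun _ => 1) (fun h => one_ne_zero (congrFun h ⟨0, hν1⟩))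
    simp at this
  let e := chartAt (EuclideanSpace ℝ (Fin d)) x
  have hx : x ∈ e.source := mem_chart_source _ x
  have hs : HasStrictFDerivAt (F ∘ e.symm)
      (mvfderiv (𝓡 d) F x : EuclideanSpace ℝ (Fin d) →L[ℝ] SymMat 𝕜 n) (e x) :=
    hF.hasStrictFDerivAt_comp_chartAt_symm x
  obtain ⟨c, hc, t₀, ht₀, N, hN, hinc⟩ := exists_eigval_increasing
    (E := EuclideanSpace ℝ (Fin d)) (k := k) (w := w) hs (by
    rw [Function.comp_apply, e.left_inv hx]
    exact SymMat.re_inner_pos_of_compression_posDef hU hw)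
  -- The chart is translated so that `x` goes to the origin.
  refine .of_openPartialHomeomorph (e.transHomeomorph (Homeomorph.subRight (e x))) hx ?_
  have h0 : (e.transHomeomorph (Homeomorph.subRight (e x))) x = 0 := sub_self _
  rw [h0]
  have htend : Filter.Tendsto (fun y => y + e x) (𝓝 0) (𝓝 (e x)) :=
    (continuous_add_const (e x)).tendsto' _ _ (zero_add _)
  refine isTopologicallyRegular_of_increasing (N := (fun y => y + e x) ⁻¹' (N ∩ e.target))
    hw0 hc ht₀ (htend (Filter.inter_mem hN (e.open_target.mem_nhds (e.map_source hx)))) ?_ ?_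
  · have h1 : ContinuousOn (fun y => (F (e.symm y)).eigval k) e.target :=
      ((SymMat.continuous_eigval k).comp hF.continuous).comp_continuousOn e.continuousOn_symm
    exact h1.comp (continuous_add_const (e x)).continuousOn fun y hy => hy.2
  · intro y hy t ht htt₀ hyt
    have h1 (v : EuclideanSpace ℝ (Fin d)) : y + t • v + e x = y + e x + t • v :=
      add_right_comm _ _ _
    have h2 := hinc (y + e x) hy.1 t ht htt₀ ((congrArg (· ∈ N) (h1 w)).mp hyt.1)
    exact h2.trans_eq (congrArg (fun z => (F (e.symm z)).eigval k) (h1 w).symm)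

end

theorem mainTheorem3 {𝕜 : Type*} [RCLike 𝕜] {d n ν : ℕ}
    {M : Type*} [TopologicalSpace M] [ChartedSpace (EuclideanSpace ℝ (Fin d)) M]
    [IsManifold (𝓡 d) ∞ M]
    (F : M → SymMat 𝕜 n) (hF : ContMDiff (𝓡 d) 𝓘(ℝ, SymMat 𝕜 n) ∞ F)
    (k : Fin n) (x : M)
    (hν : Module.finrank 𝕜 ((F x).eigspace k) = ν) (hν1 : 1 ≤ ν)
    (U : Matrix (Fin n) (Fin ν) 𝕜) (hU : IsIsometryOnto U ((F x).eigspace k)) :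
    ((∃ C ∈ LinearMap.range (compressedDeriv d F x U), (SymMat.toMat C).PosDef) ↔
      SymMat.perp (LinearMap.range (compressedDeriv d F x U)) ∩ SymMat.psdCone 𝕜 ν = {0}) ∧
    ((∃ C ∈ LinearMap.range (compressedDeriv d F x U), (SymMat.toMat C).PosDef) →
      IsTopologicallyRegular d (fun y => (F y).eigval k) x) := by
  exact ⟨SymMat.exists_posDef_iff _, isTopologicallyRegular_eigval hF hν1 hU⟩
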